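/- Let $d\in\mathbb{N}$, let $X:=[0,1]^d\subseteq\mathbb{R}^d$, and let $f\subseteq X\times\mathbb{R}$ be a total relation, i.e. $f(x):=\{y:(x,y)\in f\}\neq\emptyset$ for every $x\in X$. Suppose that $f$ maps compact sets to compact sets, i.e. $f[S]:=\bigcup_{x\in S}f(x)$ is compact for every compact $S\subseteq X$; this holds in particular if $f$ is compact as a subset of $X\times\mathbb{R}$. Then the following are equivalent. (i) $f$ is relatively computable: there are an oracle and an oracle machine which, for every $x\in X$, upon input of any $d$ sequences of integer fractions $(q_{i,n})_{n\in\mathbb{N}}$ with $|x_i-q_{i,n}|\le 2^{-n}$ for all $1\le i\le d$ and $n\in\mathbb{N}$, outputs a sequence of integer fractions $(r_m)_{m\in\mathbb{N}}$ such that, for some $y\in f(x)$, $|y-r_m|\le 2^{-m}$ for all $m\in\mathbb{N}$. (ii) $f$ is $\omega$-fold Henkin-continuous, i.e. it satisfies the infinitary formula \[ \exists\delta_1,\delta_2,\ldots>0\;\;\forall x_1\in X\;\exists y_1\in\mathbb{R}\;\forall x_2\in X\;\exists y_2\in\mathbb{R}\;\cdots:\quad y_1\in f(x_1)\;\wedge\;\bigwedge_{\ell\ge1}\Big(d(x_{\ell+1},x_\ell)\le\delta_\ell\;\rightarrow\;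 y_{\ell+1}\in f(x_{\ell+1})\,\wedge\,|y_{\ell+1}-y_\ell|\le2^{-\ell}\Big), \] read as an infinite two-player game with metric $d(\cdot,\cdot)$ on $X$: there are reals $\delta_1,\delta_2,\ldots>0$ and a strategy choosing each $y_\ell$ as a function of $x_1,\ldots,x_\ell$ such that the matrix of the formula holds for every sequence $x_1,x_2,\ldots$ in $X$. -/

import Mathlib

namespace Henkin

/-- The unit cube `[0,1]^d` in Euclidean space `ℝ^d`. -/
def unitCube (d : ℕ) : Set (EuclideanSpace ℝ (Fin d)) :=
  {x | ∀ i, x i ∈ Set.Icc (0 : ℝ) 1}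

/-! ### Relations -/

/-- The relation `f` is total: every `f(x) = {y | (x, y) ∈ f}` is non-empty. -/
def IsTotal {X Y : Type*} (f : SetRel X Y) : Prop :=
  f.dom = Set.univ

/-- The relation `f` maps compact sets to compact sets: the image
`f[S] = {y | ∃ x ∈ S, (x, y) ∈ f}` of every compact set `S` is compact. -/
def MapsCompactToCompact {X Y : Type*} [TopologicalSpace X] [TopologicalSpace Y]
    (f : SetRel X Y) : Prop :=
  ∀ S : Set X, IsCompact S → IsCompact (f.image S)

/-! ### Oracle machines with infinite inputs -/

/-- Programs of oracle machines with `d` infinite input sequences: the usual codes of partial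
recursive functions, together with one instruction that queries the oracle and, for each
`i : Fin d`, one instruction that reads an entry of the `i`-th input sequence. -/
inductive Program (d : ℕ) : Type
  | zero : Program d
  | succ : Program d
  | left : Program d
  | right : Program d
  | oracle : Program d
  | input : Fin d → Program d
  | pair : Program d → Program d → Program d
  | comp : Program d → Program d → Program d
  | prec : Program d → Program d → Program d
  | rfind : Program d → Program d

/-- The partial function `ℕ →. ℕ` computed by a program with oracle `O` (a set of natural
numbers, given by its characteristic function) on the input sequences `p 0, …, p (d - 1)`. -/
def Program.eval {d : ℕ} (O : ℕ → Bool) (p : Fin d → ℕ → ℕ) : Program d → ℕ →. ℕ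
  | zero => fun _ => Part.some 0
  | succ => fun n => Part.some (n + 1)
  | left => fun n => Part.some n.unpair.1
  | right => fun n => Part.some n.unpair.2
  | oracle => fun n => Part.some (O n).toNat
  | input i => fun n => Part.some (p i n)
  | pair cf cg => fun n => Nat.pair <$> eval O p cf n <*> eval O p cg n
  | comp cf cg => fun n => eval O p cg n >>= eval O p cf
  | prec cf cg => Nat.unpaired fun a n =>
      n.rec (eval O p cf a) fun y IH => do
        let i ← IH
        eval O p cg (Nat.pair a (Nat.pair y i))
  | rfind cf => fun a =>
      Nat.rfind fun n => (fun m => decide (m = 0)) <$> eval O p cf (Nat.pair a n)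

/-! ### Relative computability of real relations -/

/-- The integer fraction with code `k`: the code consists of a numerator in `ℤ` and a positive
denominator. Every integer fraction has a code. -/
noncomputable def frac (k : ℕ) : ℝ :=
  (Equiv.intEquivNat.symm k.unpair.1 : ℝ) / ((k.unpair.2 : ℝ) + 1)

/-- The sequence of integer fractions coded by `q` converges to `y` with error at most `2⁻ⁿ`
at the `n`-th entry. -/
def IsName (q : ℕ → ℕ) (y : ℝ) : Prop :=
  ∀ n : ℕ, |y - frac (q n)| ≤ (1 / 2 : ℝ) ^ n

/-- A relation `f : X ⇉ ℝ`, where `X ⊆ ℝ^d`, is relatively computable: some program with some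
oracle, upon input of any names `p i` of the coordinates `x i` of any point `x` of the domain
of `f`, outputs a name `q` of some `y` with `(x, y) ∈ f`. -/
def RelativelyComputable {d : ℕ} {X : Set (EuclideanSpace ℝ (Fin d))} (f : SetRel X ℝ) : Prop :=
  ∃ (O : ℕ → Bool) (c : Program d), ∀ x ∈ f.dom, ∀ p : Fin d → ℕ → ℕ,
    (∀ i, IsName (p i) ((x : EuclideanSpace ℝ (Fin d)) i)) →
      ∃ q : ℕ → ℕ, (∀ m, q m ∈ c.eval O p m) ∧ ∃ y, (x, y) ∈ f ∧ IsName q y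

/-! ### The infinitary Henkin formula -/

/-- `f : X ⇉ Y` is `ω`-fold Henkin-continuous:
`∃ δ₀, δ₁, … > 0 ∀ x₀ ∃ y₀ ∀ x₁ ∃ y₁ … : y₀ ∈ f(x₀)` and, for every `l`, if `d(x_{l+1}, x_l) ≤ δ_l`
then `y_{l+1} ∈ f(x_{l+1})` and `d(y_{l+1}, y_l) ≤ 2^{-(l+1)}`.
The infinite string of quantifiers has its game semantics: the existential player has a strategy
`s`, choosing `y_l = s l (x₀, …, x_l)`, that wins against all sequences `x₀, x₁, …`.
Indices start at `0` here, so that the tolerances are `2⁻¹, 2⁻², …`. -/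
def OmegaFoldHenkinContinuous {X Y : Type*} [MetricSpace X] [MetricSpace Y]
    (f : SetRel X Y) : Prop :=
  ∃ δ : ℕ → ℝ, (∀ l, 0 < δ l) ∧
    ∃ s : (l : ℕ) → (Fin (l + 1) → X) → Y, ∀ (x : ℕ → X) (y : ℕ → Y),
      (∀ l, y l = s l fun i => x i) →
        (x 0, y 0) ∈ f ∧
        ∀ l, dist (x (l + 1)) (x l) ≤ δ l →
          (x (l + 1), y (l + 1)) ∈ f ∧ dist (y (l + 1)) (y l) ≤ (1 / 2 : ℝ) ^ (l + 1)

end Henkin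

/-!
From a machine to a strategy: a machine reads only finitely many entries of its inputs before it
writes an entry of its output (`Program.exists_use`). Every point of the cube has names that consist of
dyadic fractions, the `n`-th entry coming from a finite set, and all such names form a compact set.
Hence the number of entries read before the `m`-th output entry is bounded uniformly
(`Program.exists_uniform_use`).
In a play `x 0, x 1, …` the player keeps a name of the current point (`playName`). The entries
already read are retained as long as the steps stay within the tolerances; the tolerances decrease
so fast that the retained entries remain within the precision required of a name
(`abs_sub_frac_playName_le`). The answer at each stage is the real that the machine computes from
the current name; consecutive names have a long common prefix, so consecutive answers are close.
After too large a step the player just starts with a new name.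

From a strategy to a machine: entries of the given name of `x`, sufficiently far out and moved into
the cube, form a sequence approaching `x` as fast as the tolerances demand. The answers of the
strategy to that play converge, and the limit lies in `f x` since the play might at any stage
continue at `x` and since `f x` is compact, hence closed (`exists_limit_of_strategy`). The `m`-th
approximation of the limit depends on a bounded number of name entries only, so that an oracle can
tabulate it, and a machine with unbounded search over its oracle computes it
(`Program.exists_oracle_search`).
-/

namespace Henkin

/-! ### Oracle programs use finitely many entries of their inputs -/

/-- The input sequences `p` and `p'` have the same entries with index below `N`. -/
def AgreeBelow {d : ℕ} (N : ℕ) (p p' : Fin d → ℕ → ℕ) : Prop :=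
  ∀ i, ∀ n < N, p i n = p' i n

theorem AgreeBelow.mono {d M N : ℕ} {p p' : Fin d → ℕ → ℕ} (h : AgreeBelow N p p')
    (hMN : M ≤ N) : AgreeBelow M p p' :=
  fun i n hn => h i n (hn.trans_le hMN)

section Eval

variable {d : ℕ} {O : ℕ → Bool} {p : Fin d → ℕ → ℕ} {cf cg : Program d} {n v : ℕ}

theorem Program.mem_eval_pair : v ∈ (Program.pair cf cg).eval O p n ↔
    ∃ a ∈ cf.eval O p n, ∃ b ∈ cg.eval O p n, Nat.pair a b = v := by
  change v ∈ (Part.map Nat.pair (cf.eval O p n)).bind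
    (fun g => Part.map g (cg.eval O p n)) ↔ _
  simp [Part.mem_bind_iff, Part.mem_map_iff]

theorem Program.mem_eval_comp : v ∈ (Program.comp cf cg).eval O p n ↔
    ∃ b ∈ cg.eval O p n, v ∈ cf.eval O p b := by
  change v ∈ Part.bind (cg.eval O p n) (cf.eval O p) ↔ _
  exact Part.mem_bind_iff

theorem Program.eval_prec_zero (a : ℕ) :
    (Program.prec cf cg).eval O p (Nat.pair a 0) = cf.eval O p a := by
  simp [Program.eval]

theorem Program.mem_eval_prec_succ (a k : ℕ) :
    v ∈ (Program.prec cf cg).eval O p (Nat.pair a (k + 1)) ↔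
    ∃ b ∈ (Program.prec cf cg).eval O p (Nat.pair a k),
      v ∈ cg.eval O p (Nat.pair a (Nat.pair k b)) := by
  simp only [Program.eval, Nat.unpaired, Nat.unpair_pair]
  exact Part.mem_bind_iff

theorem Program.mem_eval_rfind : v ∈ (Program.rfind cf).eval O p n ↔
    0 ∈ cf.eval O p (Nat.pair n v) ∧
      ∀ m < v, ∃ b ∈ cf.eval O p (Nat.pair n m), b ≠ 0 := by
  have hmap : ∀ (q : Part ℕ) (b : Bool),
      b ∈ Part.map (fun m => decide (m = 0)) q ↔ ∃ a ∈ q, decide (a = 0) = b :=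
    fun q b => Part.mem_map_iff _
  refine Nat.mem_rfind.trans (and_congr ((hmap _ _).trans ?_)
    (forall₂_congr fun m _ => (hmap _ _).trans ?_)) <;> simp

end Eval

/-- The use principle: a terminating computation reads only finitely many input entries. -/
theorem Program.exists_use {d : ℕ} (O : ℕ → Bool) (p : Fin d → ℕ → ℕ) (c : Program d) :
    ∀ n v, v ∈ c.eval O p n → ∃ N, ∀ p', AgreeBelow N p p' → v ∈ c.eval O p' n := by
  induction c with
  | zero => exact fun n v h => ⟨0, fun _ _ => h⟩
  | succ => exact fun n v h => ⟨0, fun _ _ => h⟩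
  | left => exact fun n v h => ⟨0, fun _ _ => h⟩
  | right => exact fun n v h => ⟨0, fun _ _ => h⟩
  | oracle => exact fun n v h => ⟨0, fun _ _ => h⟩
  | input i =>
    intro n v h
    refine ⟨n + 1, fun p' hp => ?_⟩
    simp only [Program.eval, Part.mem_some_iff] at h ⊢
    rw [h, hp i n n.lt_succ_self]
  | pair cf cg ihf ihg =>
    intro n v h
    simp only [Program.mem_eval_pair] at h ⊢
    obtain ⟨a, ha, b, hb, hv⟩ := h
    obtain ⟨M, hM⟩ := ihf n a ha
    obtain ⟨N, hN⟩ := ihg n b hb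
    exact ⟨max M N, fun p' hp => ⟨a, hM p' (hp.mono (le_max_left _ _)), b,
      hN p' (hp.mono (le_max_right _ _)), hv⟩⟩
  | comp cf cg ihf ihg =>
    intro n v h
    simp only [Program.mem_eval_comp] at h ⊢
    obtain ⟨b, hb, hv⟩ := h
    obtain ⟨M, hM⟩ := ihf b v hv
    obtain ⟨N, hN⟩ := ihg n b hb
    exact ⟨max M N, fun p' hp => ⟨b, hN p' (hp.mono (le_max_right _ _)),
      hM p' (hp.mono (le_max_left _ _))⟩⟩
  | prec cf cg ihf ihg =>
    intro n
    rw [← Nat.pair_unpair n]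
    induction n.unpair.2 with
    | zero => simpa only [Program.eval_prec_zero] using ihf _
    | succ k ih =>
      intro v h
      simp only [Program.mem_eval_prec_succ] at h ⊢
      obtain ⟨b, hb, hv⟩ := h
      obtain ⟨M, hM⟩ := ih b hb
      obtain ⟨N, hN⟩ := ihg _ v hv
      exact ⟨max M N, fun p' hp => ⟨b, hM p' (hp.mono (le_max_left _ _)),
        hN p' (hp.mono (le_max_right _ _))⟩⟩
  | rfind cf ih =>
    intro n v h
    simp only [Program.mem_eval_rfind] at h ⊢
    obtain ⟨h0, hlt⟩ := h
    obtain ⟨M, hM⟩ := ih _ 0 h0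
    have hex : ∀ m, ∃ N, m < v → ∀ p', AgreeBelow N p p' →
        ∃ b ∈ cf.eval O p' (Nat.pair n m), b ≠ 0 := by
      intro m
      by_cases hm : m < v
      · obtain ⟨b, hb, hb0⟩ := hlt m hm
        obtain ⟨N, hN⟩ := ih _ b hb
        exact ⟨N, fun _ p' hp => ⟨b, hN p' hp, hb0⟩⟩
      · exact ⟨0, fun h => absurd h hm⟩
    choose N hN using hex
    refine ⟨max M ((Finset.range v).sup N), fun p' hp =>
      ⟨hM p' (hp.mono (le_max_left _ _)), fun m hm => hN m hm p' (hp.mono ?_)⟩⟩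
    exact (Finset.le_sup (f := N) (Finset.mem_range.2 hm)).trans (le_max_right _ _)

/-- On a compact set of inputs on which a program terminates, its use is bounded uniformly. -/
theorem Program.exists_uniform_use {d : ℕ} (O : ℕ → Bool) (c : Program d) (n : ℕ)
    {K : Set (Fin d → ℕ → ℕ)} (hK : IsCompact K) (h : ∀ p ∈ K, ∃ v, v ∈ c.eval O p n) :
    ∃ N, ∀ p ∈ K, ∀ p', AgreeBelow N p p' → ∀ v ∈ c.eval O p n, v ∈ c.eval O p' n := by
  have hex : ∀ p : Fin d → ℕ → ℕ, ∃ N, p ∈ K →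
      ∃ v, ∀ p', AgreeBelow N p p' → v ∈ c.eval O p' n := by
    intro p
    by_cases hp : p ∈ K
    · obtain ⟨v, hv⟩ := h p hp
      obtain ⟨N, hN⟩ := c.exists_use O p n v hv
      exact ⟨N, fun _ => ⟨v, hN⟩⟩
    · exact ⟨0, fun h => absurd h hp⟩
  choose N hN using hex
  have hnhds : ∀ p ∈ K, {p' | AgreeBelow (N p) p p'} ∈ nhds p := by
    intro p _
    refine IsOpen.mem_nhds ?_ (fun _ _ _ => rfl)
    have : {p' | AgreeBelow (N p) p p'} =
        ⋂ i, ⋂ n ∈ Set.Iio (N p), (fun p' : Fin d → ℕ → ℕ => p' i n) ⁻¹' {p i n} := by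
      ext p'
      simp [AgreeBelow, eq_comm]
    rw [this]
    exact isOpen_iInter_of_finite fun i => (Set.finite_Iio _).isOpen_biInter fun n _ =>
      (isOpen_discrete _).preimage ((continuous_apply n).comp (continuous_apply i))
  obtain ⟨t, htK, ht⟩ := hK.elim_nhds_subcover _ hnhds
  refine ⟨t.sup N, fun p hp p' hpp' v hv => ?_⟩
  obtain ⟨q, hqt, hqp⟩ := Set.mem_iUnion₂.1 (ht hp)
  obtain ⟨w, hw⟩ := hN q (htK q hqt)
  have hqp' : AgreeBelow (N q) q p' := fun i n hn =>
    (hqp i n hn).trans ((hpp'.mono (Finset.le_sup hqt)) i n hn)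
  rw [Part.mem_unique hv (hw p hqp)]
  exact hw p' hqp'

/-! ### Dyadic names -/

/-- The code of the fraction `a / 2 ^ (n + 1)`. -/
def dyadicCode (n : ℕ) (a : ℤ) : ℕ :=
  Nat.pair (Equiv.intEquivNat a) (2 ^ (n + 1) - 1)

theorem frac_dyadicCode (n : ℕ) (a : ℤ) : frac (dyadicCode n a) = a / 2 ^ (n + 1) := by
  have h : (1 : ℕ) ≤ 2 ^ (n + 1) := Nat.one_le_two_pow
  simp [frac, dyadicCode, Nat.cast_sub h]

/-- The code of the largest multiple of `2 ^ (-(n + 1))` that is at most `x`. -/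
noncomputable def dyadicFloor (x : ℝ) (n : ℕ) : ℕ :=
  dyadicCode n ⌊x * 2 ^ (n + 1)⌋

/-- Rounding to twice the precision required of a name leaves room for the represented point
to be moved. -/
theorem abs_sub_frac_dyadicFloor_le (x : ℝ) (n : ℕ) :
    |x - frac (dyadicFloor x n)| ≤ (1 / 2 : ℝ) ^ (n + 1) := by
  have hpos : (0 : ℝ) < 2 ^ (n + 1) := by positivity
  have h1 := Int.floor_le (x * 2 ^ (n + 1))
  have h2 := Int.lt_floor_add_one (x * 2 ^ (n + 1))
  have : x - frac (dyadicFloor x n) = (x * 2 ^ (n + 1) - ⌊x * 2 ^ (n + 1)⌋) / 2 ^ (n + 1) := by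
    rw [dyadicFloor, frac_dyadicCode]
    field_simp
  rw [this, abs_of_nonneg (by apply div_nonneg <;> linarith), one_div, inv_pow, ← one_div]
  gcongr
  linarith

theorem exists_abs_sub_frac_le (y : ℝ) (n : ℕ) : ∃ k, |y - frac k| ≤ (1 / 2 : ℝ) ^ n :=
  ⟨_, (abs_sub_frac_dyadicFloor_le y n).trans
    (pow_le_pow_of_le_one (by norm_num) (by norm_num) n.le_succ)⟩

/-- The codes of the multiples of `2 ^ (-(n + 1))` in `[0, 1]`. -/
def dyadicCodes (n : ℕ) : Set ℕ :=
  dyadicCode n '' Set.Icc 0 (2 ^ (n + 1))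

theorem dyadicFloor_mem_dyadicCodes {x : ℝ} (hx : x ∈ Set.Icc (0 : ℝ) 1) (n : ℕ) :
    dyadicFloor x n ∈ dyadicCodes n := by
  have hpos : (0 : ℝ) < 2 ^ (n + 1) := by positivity
  refine ⟨_, ⟨Int.floor_nonneg.2 (mul_nonneg hx.1 hpos.le), ?_⟩, rfl⟩
  have h := Int.floor_le (x * 2 ^ (n + 1))
  have : (⌊x * 2 ^ (n + 1)⌋ : ℝ) ≤ ((2 ^ (n + 1) : ℤ) : ℝ) := by
    push_cast
    nlinarith [hx.2]
  exact_mod_cast this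

theorem isCompact_unitCube (d : ℕ) : IsCompact (unitCube d) := by
  have : unitCube d = (EuclideanSpace.equiv (Fin d) ℝ).toHomeomorph ⁻¹'
      Set.pi Set.univ fun _ => Set.Icc (0 : ℝ) 1 := by
    ext x
    simp [unitCube, -Set.pi_univ_Icc, Set.mem_pi]
  rw [this, Homeomorph.isCompact_preimage]
  exact isCompact_univ_pi fun _ => isCompact_Icc

/-- The input sequences with entries among the `dyadicCodes` that are names of the coordinates
of some point of the cube. -/
def dyadicNames (d : ℕ) : Set (Fin d → ℕ → ℕ) :=
  {p | (∀ i n, p i n ∈ dyadicCodes n) ∧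
    ∃ x : unitCube d, ∀ i, IsName (p i) ((x : EuclideanSpace ℝ (Fin d)) i)}

theorem isCompact_dyadicNames (d : ℕ) : IsCompact (dyadicNames d) := by
  have : CompactSpace (unitCube d) := isCompact_iff_compactSpace.1 (isCompact_unitCube d)
  have hclosed : IsClosed {z : unitCube d × (Fin d → ℕ → ℕ) |
      ∀ i n, |(z.1 : EuclideanSpace ℝ (Fin d)) i - frac (z.2 i n)| ≤ (1 / 2 : ℝ) ^ n} := by
    simp only [Set.ofPred_forall]
    refine isClosed_iInter fun i => isClosed_iInter fun n => isClosed_le ?_ continuous_const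
    have h1 : Continuous fun z : unitCube d × (Fin d → ℕ → ℕ) =>
        (z.1 : EuclideanSpace ℝ (Fin d)) i := by fun_prop
    have h2 : Continuous fun z : unitCube d × (Fin d → ℕ → ℕ) => frac (z.2 i n) :=
      (continuous_of_discreteTopology (f := frac)).comp
        ((continuous_apply n).comp ((continuous_apply i).comp continuous_snd))
    exact (h1.sub h2).abs
  have hpi : IsCompact (Set.pi Set.univ fun _ : Fin d => Set.pi Set.univ dyadicCodes) :=
    isCompact_univ_pi fun _ => isCompact_univ_pi fun n =>
      ((Set.finite_Icc _ _).image _).isCompact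
  convert (((isCompact_univ (X := unitCube d)).prod hpi).inter_right hclosed).image
    continuous_snd using 1
  ext p
  simp [dyadicNames, IsName, Set.mem_pi]

/-! ### The strategy given by an oracle program -/

/-- The names that the existential player feeds to the program in a play `x 0, x 1, …`. As long
as the distances stay within the tolerance `δ`, the name at stage `l + 1` keeps the entries below
`n l` of its predecessor, and it continues with the dyadic roundings of `x (l + 1)`; after a
larger step the player starts afresh. -/
noncomputable def playName {d : ℕ} (n : ℕ → ℕ) (δ : ℕ → ℝ) (x : ℕ → unitCube d) :
    ℕ → Fin d → ℕ → ℕ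
  | 0 => fun i => dyadicFloor ((x 0 : EuclideanSpace ℝ (Fin d)) i)
  | l + 1 => fun i k =>
      open Classical in
      if dist (x (l + 1)) (x l) ≤ δ l ∧ k < n l then playName n δ x l i k
      else dyadicFloor ((x (l + 1) : EuclideanSpace ℝ (Fin d)) i) k

theorem playName_congr {d : ℕ} (n : ℕ → ℕ) (δ : ℕ → ℝ) {x x' : ℕ → unitCube d} (l : ℕ)
    (h : ∀ j ≤ l, x j = x' j) : playName n δ x l = playName n δ x' l := by
  induction l with
  | zero => simp only [playName, h 0 le_rfl]
  | succ l ih =>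
    simp only [playName, h (l + 1) le_rfl, h l l.le_succ, ih fun j hj => h j (hj.trans l.le_succ)]

theorem playName_mem_dyadicCodes {d : ℕ} (n : ℕ → ℕ) (δ : ℕ → ℝ) (x : ℕ → unitCube d) (l : ℕ)
    (i : Fin d) (k : ℕ) : playName n δ x l i k ∈ dyadicCodes k := by
  induction l with
  | zero => exact dyadicFloor_mem_dyadicCodes ((x 0).2 i) k
  | succ l ih =>
    simp only [playName]
    split_ifs
    · exact ih
    · exact dyadicFloor_mem_dyadicCodes ((x (l + 1)).2 i) k

theorem agreeBelow_playName {d : ℕ} (n : ℕ → ℕ) (δ : ℕ → ℝ) (x : ℕ → unitCube d) {l : ℕ}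
    (h : dist (x (l + 1)) (x l) ≤ δ l) :
    AgreeBelow (n l) (playName n δ x l) (playName n δ x (l + 1)) :=
  fun i k hk => by simp [playName, h, hk]

/-- If the tolerances are `2 ^ (-(n l + 1))`, the entries below `n l` keep a reserve of
`2 ^ (-n l)`, enough for all later admissible steps of the play. -/
theorem abs_sub_frac_playName_le {d : ℕ} {n : ℕ → ℕ} (hn : StrictMono n) (x : ℕ → unitCube d)
    (l : ℕ) (i : Fin d) (k : ℕ) :
    |(x l : EuclideanSpace ℝ (Fin d)) i -
        frac (playName n (fun l => (1 / 2 : ℝ) ^ (n l + 1)) x l i k)| ≤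
      (1 / 2 : ℝ) ^ k - if k < n l then (1 / 2 : ℝ) ^ n l else 0 := by
  have hfresh : ∀ l, |(x l : EuclideanSpace ℝ (Fin d)) i -
      frac (dyadicFloor ((x l : EuclideanSpace ℝ (Fin d)) i) k)| ≤
      (1 / 2 : ℝ) ^ k - if k < n l then (1 / 2 : ℝ) ^ n l else 0 := by
    intro l
    refine (abs_sub_frac_dyadicFloor_le _ k).trans ?_
    split_ifs with hk
    · have := pow_le_pow_of_le_one (by norm_num : (0 : ℝ) ≤ 1 / 2) (by norm_num)
        (Nat.succ_le_of_lt hk)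
      rw [Nat.succ_eq_add_one] at this
      rw [pow_succ] at this ⊢
      linarith
    · rw [pow_succ]
      have : (0 : ℝ) < (1 / 2) ^ k := by positivity
      linarith
  induction l with
  | zero => exact hfresh 0
  | succ l ih =>
    simp only [playName]
    split_ifs with h hk hk
    · rw [if_pos h.2] at ih
      have hdist : |(x (l + 1) : EuclideanSpace ℝ (Fin d)) i -
          (x l : EuclideanSpace ℝ (Fin d)) i| ≤ (1 / 2 : ℝ) ^ (n l + 1) := by
        refine le_trans ?_ h.1
        rw [Subtype.dist_eq, dist_eq_norm]
        exact PiLp.norm_apply_le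
          ((x (l + 1) : EuclideanSpace ℝ (Fin d)) - (x l : EuclideanSpace ℝ (Fin d))) i
      have hstep := pow_le_pow_of_le_one (by norm_num : (0 : ℝ) ≤ 1 / 2) (by norm_num)
        (Nat.succ_le_of_lt (hn l.lt_succ_self))
      rw [Nat.succ_eq_add_one] at hstep
      refine (abs_sub_le _ ((x l : EuclideanSpace ℝ (Fin d)) i) _).trans ?_
      rw [pow_succ] at hstep hdist
      linarith
    · exact absurd (h.2.trans (hn l.lt_succ_self)) hk
    · simpa [hk] using hfresh (l + 1)
    · simpa [hk] using hfresh (l + 1)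

theorem isName_playName {d : ℕ} {n : ℕ → ℕ} (hn : StrictMono n) (x : ℕ → unitCube d) (l : ℕ)
    (i : Fin d) : IsName (playName n (fun l => (1 / 2 : ℝ) ^ (n l + 1)) x l i)
      ((x l : EuclideanSpace ℝ (Fin d)) i) := by
  intro k
  refine (abs_sub_frac_playName_le hn x l i k).trans (sub_le_self _ ?_)
  split_ifs <;> positivity

theorem RelativelyComputable.omegaFoldHenkinContinuous {d : ℕ} {f : SetRel (unitCube d) ℝ}
    (hf : IsTotal f) (h : RelativelyComputable f) : OmegaFoldHenkinContinuous f := by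
  obtain ⟨O, c, hc⟩ := h
  replace hc : ∀ x : unitCube d, ∀ p : Fin d → ℕ → ℕ,
      (∀ i, IsName (p i) ((x : EuclideanSpace ℝ (Fin d)) i)) →
      ∃ y, (x, y) ∈ f ∧ ∃ q : ℕ → ℕ, (∀ m, q m ∈ c.eval O p m) ∧ IsName q y := by
    intro x p hp
    have hx : x ∈ f.dom := by rw [show f.dom = Set.univ from hf]; trivial
    obtain ⟨q, hq, y, hy, hqy⟩ := hc x hx p hp
    exact ⟨y, hy, q, hq, hqy⟩
  -- `N m` bounds the use of the `m`-th output entry.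
  have hN : ∀ m, ∃ N, ∀ p ∈ dyadicNames d, ∀ p', AgreeBelow N p p' →
      ∀ v ∈ c.eval O p m, v ∈ c.eval O p' m := by
    refine fun m => c.exists_uniform_use O m (isCompact_dyadicNames d) ?_
    rintro p ⟨_, x, hx⟩
    obtain ⟨_, _, q, hq, _⟩ := hc x p hx
    exact ⟨q m, hq m⟩
  choose N hN using hN
  obtain ⟨n, hn, hNn⟩ : ∃ n : ℕ → ℕ, StrictMono n ∧ ∀ l, N (l + 2) ≤ n l := by
    refine ⟨fun l => ∑ j ∈ Finset.range (l + 1), (N (j + 2) + 1), ?_, fun l => ?_⟩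
    · exact strictMono_nat_of_lt_succ fun l => by
        rw [Finset.sum_range_succ _ (l + 1)]
        omega
    · simp only [Finset.sum_range_succ]
      omega
  have hplay := fun (x : ℕ → unitCube d) l => hc (x l) _ (isName_playName hn x l)
  set δ : ℕ → ℝ := fun l => (1 / 2 : ℝ) ^ (n l + 1)
  classical
  -- The answer to a name `p` of the point `x` is a real named by the output of the program.
  let answer : unitCube d → (Fin d → ℕ → ℕ) → ℝ := fun x p =>
    if hp : ∀ i, IsName (p i) ((x : EuclideanSpace ℝ (Fin d)) i) then (hc x p hp).choose else 0
  have hanswer : ∀ (x : unitCube d) (p : Fin d → ℕ → ℕ), (∀ i, IsName (p i) ((x : EuclideanSpace ℝ (Fin d)) i)) →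
      (x, answer x p) ∈ f ∧
        ∃ q : ℕ → ℕ, (∀ m, q m ∈ c.eval O p m) ∧ IsName q (answer x p) := by
    intro x p hp
    simp only [answer, dif_pos hp]
    exact (hc x p hp).choose_spec
  let extend : (l : ℕ) → (Fin (l + 1) → unitCube d) → ℕ → unitCube d := fun l v j =>
    if hj : j < l + 1 then v ⟨j, hj⟩ else v 0
  refine ⟨δ, fun l => by positivity,
    fun l v => answer (v (Fin.last l)) (playName n δ (extend l v) l), fun x y hy => ?_⟩
  replace hy : ∀ l, y l = answer (x l) (playName n δ x l) := by
    intro l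
    have hext : ∀ j ≤ l, extend l (fun i => x i) j = x j := fun j hj => by
      simp [extend, Nat.not_lt.2 hj]
    rw [hy l, ← playName_congr n δ l hext]
    simp
  have hall : ∀ l, (x l, y l) ∈ f ∧
      ∃ q : ℕ → ℕ, (∀ m, q m ∈ c.eval O (playName n δ x l) m) ∧ IsName q (y l) := by
    intro l
    rw [hy l]
    exact hanswer _ _ (isName_playName hn x l)
  refine ⟨(hall 0).1, fun l hl => ⟨(hall (l + 1)).1, ?_⟩⟩
  obtain ⟨_, q, hq, hqy⟩ := hall l
  obtain ⟨_, q', hq', hqy'⟩ := hall (l + 1)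
  have hmem : playName n δ x l ∈ dyadicNames d :=
    ⟨playName_mem_dyadicCodes n δ x l, x l, isName_playName hn x l⟩
  have hqq' : q (l + 2) = q' (l + 2) := Part.mem_unique
    (hN _ _ hmem _ ((agreeBelow_playName n δ x hl).mono (hNn l)) _ (hq _)) (hq' _)
  have h1 := hqy (l + 2)
  have h2 := hqy' (l + 2)
  rw [hqq', abs_sub_comm] at h1
  rw [Real.dist_eq]
  refine (abs_sub_le _ (frac (q' (l + 2))) _).trans ?_
  rw [pow_succ] at h1 h2
  linarith

/-! ### A program that searches for the answer of its oracle -/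

/-- The list of the `n`-th entries of the input sequences with indices in a list, as a number. -/
def columnCode {d : ℕ} (p : Fin d → ℕ → ℕ) (n : ℕ) : List (Fin d) → ℕ
  | [] => 0
  | i :: l => Nat.pair (p i n) (columnCode p n l)

theorem columnCode_inj {d : ℕ} {p p' : Fin d → ℕ → ℕ} {n : ℕ} {l : List (Fin d)}
    (h : columnCode p n l = columnCode p' n l) : ∀ i ∈ l, p i n = p' i n := by
  induction l with
  | nil => simp
  | cons j l ih =>
    obtain ⟨h1, h2⟩ := Nat.pair_eq_pair.1 h
    simp only [List.mem_cons, forall_eq_or_imp]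
    exact ⟨h1, ih h2⟩

/-- The entries with index below `k` of all input sequences, as a number. -/
def prefixCode {d : ℕ} (p : Fin d → ℕ → ℕ) : ℕ → ℕ
  | 0 => 0
  | k + 1 => Nat.pair (columnCode p k (List.finRange d)) (prefixCode p k)

theorem agreeBelow_of_prefixCode_eq {d k : ℕ} {p p' : Fin d → ℕ → ℕ}
    (h : prefixCode p k = prefixCode p' k) : AgreeBelow k p p' := by
  induction k with
  | zero => exact fun i n hn => absurd hn n.not_lt_zero
  | succ k ih =>
    obtain ⟨h1, h2⟩ := Nat.pair_eq_pair.1 h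
    intro i n hn
    rcases Nat.lt_succ_iff_lt_or_eq.1 hn with hn | rfl
    · exact ih h2 i n hn
    · exact columnCode_inj h1 i (List.mem_finRange i)

/-- The program for `columnCode`. -/
def Program.column {d : ℕ} : List (Fin d) → Program d
  | [] => .zero
  | i :: l => .pair (.input i) (Program.column l)

theorem Program.columnCode_mem_eval {d : ℕ} (O : ℕ → Bool) (p : Fin d → ℕ → ℕ)
    (l : List (Fin d)) (n : ℕ) : columnCode p n l ∈ (Program.column l).eval O p n := by
  induction l with
  | nil => exact Part.mem_some _
  | cons i l ih => exact Program.mem_eval_pair.2 ⟨_, Part.mem_some _, _, ih, rfl⟩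

/-- The program for `prefixCode`. -/
def Program.inputPrefix (d : ℕ) : Program d :=
  .prec .zero (.pair (.comp (.column (List.finRange d)) (.comp .left .right))
    (.comp .right .right))

theorem Program.prefixCode_mem_eval {d : ℕ} (O : ℕ → Bool) (p : Fin d → ℕ → ℕ) (m k : ℕ) :
    prefixCode p k ∈ (Program.inputPrefix d).eval O p (Nat.pair m k) := by
  induction k with
  | zero =>
    rw [Program.inputPrefix, Program.eval_prec_zero]
    exact Part.mem_some _
  | succ k ih =>
    refine (Program.mem_eval_prec_succ _ _).2 ⟨_, ih, Program.mem_eval_pair.2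
      ⟨columnCode p k (List.finRange d), Program.mem_eval_comp.2 ⟨k, ?_,
        Program.columnCode_mem_eval O p _ k⟩, prefixCode p k, ?_, rfl⟩⟩
    · exact Program.mem_eval_comp.2 ⟨Nat.pair k (prefixCode p k), by simp [Program.eval],
        by simp [Program.eval]⟩
    · exact Program.mem_eval_comp.2 ⟨Nat.pair k (prefixCode p k), by simp [Program.eval],
        by simp [Program.eval]⟩

/-- The program that, on input `m`, searches for the first `k` such that the oracle rejects
`m` together with `k` and the entries below `k` of all input sequences, and returns the second
component of `k`. -/
def Program.search (d : ℕ) : Program d :=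
  .comp .right (.rfind (.comp .oracle (.pair .left (.pair .right (.inputPrefix d)))))

/-- If the `m`-th entry of `R p` depends only on the entries of `p` below `M m`, then `R` is
computed by the search program with a suitable oracle. -/
theorem Program.exists_oracle_search {d : ℕ} (R : (Fin d → ℕ → ℕ) → ℕ → ℕ) (M : ℕ → ℕ)
    (hR : ∀ m p p', AgreeBelow (M m) p p' → R p m = R p' m) :
    ∃ O : ℕ → Bool, ∀ p m, R p m ∈ (Program.search d).eval O p m := by
  classical
  -- The oracle rejects exactly the codes of `k = ⟨M m, R p m⟩`; as `M m ≤ k`, the entries of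
  -- `p` below `k` determine `R p m`.
  let O : ℕ → Bool := fun z => !decide (∃ m p, z = Nat.pair m
    (Nat.pair (Nat.pair (M m) (R p m)) (prefixCode p (Nat.pair (M m) (R p m)))))
  refine ⟨O, fun p m => ?_⟩
  have hO : ∀ k, O (Nat.pair m (Nat.pair k (prefixCode p k))) = false ↔
      k = Nat.pair (M m) (R p m) := by
    intro k
    simp only [O, Bool.not_eq_false', decide_eq_true_eq]
    constructor
    · rintro ⟨m', p', h⟩
      obtain ⟨rfl, h⟩ := Nat.pair_eq_pair.1 h
      obtain ⟨hk, h⟩ := Nat.pair_eq_pair.1 h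
      rw [← hk] at h
      rw [hR m p p' ((agreeBelow_of_prefixCode_eq h).mono ?_), hk]
      rw [hk]
      exact Nat.left_le_pair _ _
    · rintro rfl
      exact ⟨m, p, rfl⟩
  have hquery : ∀ k, (O (Nat.pair m (Nat.pair k (prefixCode p k)))).toNat ∈
      (Program.comp .oracle (.pair .left (.pair .right (.inputPrefix d)))).eval O p
        (Nat.pair m k) := by
    intro k
    refine Program.mem_eval_comp.2 ⟨_, Program.mem_eval_pair.2 ⟨m, by simp [Program.eval], _,
      Program.mem_eval_pair.2 ⟨k, by simp [Program.eval], _,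
        Program.prefixCode_mem_eval O p m k, rfl⟩, rfl⟩, Part.mem_some _⟩
  refine Program.mem_eval_comp.2 ⟨Nat.pair (M m) (R p m), Program.mem_eval_rfind.2
    ⟨?_, fun k hk => ⟨_, hquery k, ?_⟩⟩, by simp [Program.eval]⟩
  · simpa only [(hO _).2 rfl, Bool.toNat_false] using hquery (Nat.pair (M m) (R p m))
  · have hne : O (Nat.pair m (Nat.pair k (prefixCode p k))) = true := by
      rw [← Bool.not_eq_false, hO]
      exact hk.ne
    simp [hne]

/-! ### The program given by a strategy -/

/-- The point of the cube whose coordinates are the reals `v i`, truncated to `[0, 1]`. -/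
noncomputable def clampCube {d : ℕ} (v : Fin d → ℝ) : unitCube d :=
  ⟨WithLp.toLp 2 fun i => Set.projIcc (0 : ℝ) 1 zero_le_one (v i), fun _ => Subtype.prop _⟩

theorem abs_sub_clampCube_le {d : ℕ} (x : unitCube d) (v : Fin d → ℝ) (i : Fin d) :
    |(x : EuclideanSpace ℝ (Fin d)) i - (clampCube v : EuclideanSpace ℝ (Fin d)) i| ≤
      |(x : EuclideanSpace ℝ (Fin d)) i - v i| := by
  have h := Set.abs_projIcc_sub_projIcc (c := (x : EuclideanSpace ℝ (Fin d)) i) (d := v i)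
    (zero_le_one' ℝ)
  rwa [Set.projIcc_of_mem _ (x.2 i)] at h

/-- Points of Euclidean space with coordinates close enough to each other are close. -/
theorem exists_forall_abs_sub_le_imp_dist_le (d : ℕ) {ε : ℝ} (hε : 0 < ε) :
    ∃ n : ℕ, ∀ x y : EuclideanSpace ℝ (Fin d),
      (∀ i, |x i - y i| ≤ (1 / 2 : ℝ) ^ n) → dist x y ≤ ε := by
  obtain ⟨η, hη, h⟩ := Metric.uniformContinuous_iff.1
    (PiLp.uniformContinuous_toLp 2 fun _ : Fin d => ℝ) ε hε
  obtain ⟨n, hn⟩ := exists_pow_lt_of_lt_one hη (by norm_num : (1 / 2 : ℝ) < 1)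
  refine ⟨n, fun x y hxy => le_of_lt (h (a := WithLp.ofLp x) (b := WithLp.ofLp y) ?_)⟩
  exact (dist_pi_lt_iff hη).2 fun i => (hxy i).trans_lt hn

/-- If `f x` is closed, the answers of a winning strategy to any sequence that
approaches `x` fast enough converge to an element of `f x`: at each stage the play might
continue at `x` itself, so that the strategy would have to find an element of `f x` nearby. -/
theorem exists_limit_of_strategy {X Y : Type*} [MetricSpace X] [MetricSpace Y]
    [CompleteSpace Y] {f : SetRel X Y} {δ : ℕ → ℝ}
    {s : (l : ℕ) → (Fin (l + 1) → X) → Y}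
    (hs : ∀ (x : ℕ → X) (y : ℕ → Y), (∀ l, y l = s l fun i => x i) →
      (x 0, y 0) ∈ f ∧ ∀ l, dist (x (l + 1)) (x l) ≤ δ l →
        (x (l + 1), y (l + 1)) ∈ f ∧ dist (y (l + 1)) (y l) ≤ (1 / 2 : ℝ) ^ (l + 1))
    {x : X} (hx : IsClosed {y | (x, y) ∈ f}) {u : ℕ → X}
    (hu : ∀ l, dist (u (l + 1)) (u l) ≤ δ l) (hux : ∀ l, dist x (u l) ≤ δ l) :
    ∃ y, (x, y) ∈ f ∧ ∀ l, dist (s l fun i => u i) y ≤ (1 / 2 : ℝ) ^ l := by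
  set w : ℕ → Y := fun l => s l fun i => u i with hw
  have hstep : ∀ l, dist (w l) (w (l + 1)) ≤ 1 / 2 / 2 ^ l := by
    intro l
    rw [dist_comm]
    refine (((hs u w fun _ => rfl).2 l (hu l)).2).trans_eq ?_
    rw [one_div, inv_pow, pow_succ]
    field_simp
  obtain ⟨y, hy⟩ := cauchySeq_tendsto_of_complete (cauchySeq_of_le_geometric_two hstep)
  have hlim : ∀ l, dist (w l) y ≤ (1 / 2 : ℝ) ^ l := by
    intro l
    refine (dist_le_of_le_geometric_two_of_tendsto hstep hy l).trans_eq ?_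
    rw [one_div_pow]
  refine ⟨y, ?_, hlim⟩
  have hnear : ∀ l, ∃ z, (x, z) ∈ f ∧ dist (w l) z ≤ (1 / 2 : ℝ) ^ (l + 1) := by
    intro l
    let u' : ℕ → X := fun j => if j ≤ l then u j else x
    have hul : u' l = u l := by simp [u']
    have hul' : u' (l + 1) = x := by simp [u']
    have hwl : (s l fun i => u' i) = w l := by
      simp only [hw]
      congr 1
      funext i
      simp [u', Nat.lt_succ_iff.1 i.2]
    have h := (hs u' _ fun _ => rfl).2 l (by rw [hul, hul']; exact hux l)
    rw [hul', hwl, dist_comm] at h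
    exact ⟨_, h.1, h.2⟩
  choose z hz hwz using hnear
  suffices hzy : Filter.Tendsto z Filter.atTop (nhds y) by
    have hmem : y ∈ {y | (x, y) ∈ f} := hx.mem_of_tendsto hzy (Filter.Eventually.of_forall hz)
    exact hmem
  refine hy.congr_dist (squeeze_zero (fun _ => dist_nonneg) hwz ?_)
  exact (tendsto_pow_atTop_nhds_zero_of_lt_one (by norm_num) (by norm_num)).comp
    (Filter.tendsto_add_atTop_nat 1)

theorem OmegaFoldHenkinContinuous.relativelyComputable {d : ℕ} {f : SetRel (unitCube d) ℝ}
    (hf : ∀ x, IsClosed {y | (x, y) ∈ f}) (h : OmegaFoldHenkinContinuous f) :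
    RelativelyComputable f := by
  obtain ⟨δ, hδ, s, hs⟩ := h
  choose n₀ hn₀ using fun l =>
    exists_forall_abs_sub_le_imp_dist_le d (half_pos (hδ l))
  -- A monotone sequence of indices `n l` such that the `n l`-th entries of a name of `x` lie
  -- within half of each of the tolerances `δ 0, …, δ l` from `x`.
  let n : ℕ → ℕ := fun l => ∑ j ∈ Finset.range (l + 1), n₀ j
  have hn : Monotone n := fun a b hab => Finset.sum_le_sum_of_subset
    (Finset.range_subset_range.2 (Nat.succ_le_succ hab))
  have hn₀n : ∀ l, n₀ l ≤ n l := fun l =>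
    Finset.single_le_sum (f := n₀) (fun _ _ => Nat.zero_le _) (Finset.self_mem_range_succ l)
  let u : (Fin d → ℕ → ℕ) → ℕ → unitCube d := fun p l => clampCube fun i => frac (p i (n l))
  -- The `m`-th output entry approximates the position `m + 1` of the play `u p`.
  choose approx happrox using exists_abs_sub_frac_le
  obtain ⟨O, hO⟩ := Program.exists_oracle_search
    (fun p m => approx (s (m + 1) fun i => u p i) (m + 1)) (fun m => n (m + 1) + 1) (by
      intro m p p' hp
      have : ∀ i : Fin (m + 1 + 1), u p i = u p' i := by
        intro i
        simp only [u]
        congr 1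
        funext j
        rw [hp j _ (Nat.lt_succ_of_le (hn (Nat.lt_succ_iff.1 i.2)))]
      simp only [this])
  refine ⟨O, Program.search d, fun x _ p hp => ⟨_, hO p, ?_⟩⟩
  have hclose : ∀ l k, l ≤ k → dist x (u p k) ≤ δ l / 2 := by
    intro l k hlk
    refine hn₀ l _ _ fun i => (abs_sub_clampCube_le x _ i).trans ((hp i (n k)).trans ?_)
    exact pow_le_pow_of_le_one (by norm_num) (by norm_num) ((hn₀n l).trans (hn hlk))
  obtain ⟨y, hy, hlim⟩ := exists_limit_of_strategy hs (hf x) (u := u p)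
    (fun l => by
      have h1 := hclose l l le_rfl
      have h2 := hclose l (l + 1) l.le_succ
      have := dist_triangle_left (u p (l + 1)) (u p l) x
      linarith)
    (fun l => (hclose l l le_rfl).trans (half_le_self (hδ l).le))
  refine ⟨y, hy, fun m => ?_⟩
  have h1 := hlim (m + 1)
  have h2 := happrox (s (m + 1) fun i => u p i) (m + 1)
  rw [dist_comm, Real.dist_eq] at h1
  refine (abs_sub_le _ (s (m + 1) fun i => u p i) _).trans ?_
  rw [pow_succ] at h1 h2
  linarith

/-! ### Compactness of images -/

theorem MapsCompactToCompact.isClosed_fiber {X Y : Type*} [TopologicalSpace X]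
    [TopologicalSpace Y] [T2Space Y] {f : SetRel X Y} (hf : MapsCompactToCompact f) (x : X) :
    IsClosed {y | (x, y) ∈ f} := by
  have h := (hf {x} isCompact_singleton).isClosed
  have heq : f.image {x} = {y | (x, y) ∈ f} := by
    ext y
    simp [SetRel.mem_image]
  rwa [heq] at h

theorem mapsCompactToCompact_of_isCompact {X Y : Type*} [TopologicalSpace X] [T2Space X]
    [TopologicalSpace Y] {f : SetRel X Y} (hf : IsCompact (f : Set (X × Y))) :
    MapsCompactToCompact f := by
  intro S hS
  have h := (hf.inter_right (hS.isClosed.preimage continuous_fst)).image continuous_snd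
  convert h using 1
  ext y
  simp [SetRel.mem_image, and_comm]

end Henkin

theorem corollary1 (d : ℕ) (f : SetRel (Henkin.unitCube d) ℝ) (hf : Henkin.IsTotal f) :
    (Henkin.MapsCompactToCompact f →
      (Henkin.RelativelyComputable f ↔ Henkin.OmegaFoldHenkinContinuous f)) ∧
    (IsCompact (f : Set (Henkin.unitCube d × ℝ)) → Henkin.MapsCompactToCompact f) :=
  ⟨fun hc => ⟨fun h => h.omegaFoldHenkinContinuous hf,
    fun h => h.relativelyComputable hc.isClosed_fiber⟩,
    Henkin.mapsCompactToCompact_of_isCompact⟩
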